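/- Let $N,T\ge 1$ and $d_X+d_Y\ge 1$. Each of $N$ workers $i\in\mathcal N=\{1,\dots,N\}$ holds one sample, consisting of an input $x_i\in[0,1]^{d_X}$ and a one-hot label $l_i\in\{0,1\}^{d_Y}$; the sample of a worker may also have been removed, in which case this worker contributes $x_i=0$ and $l_i=0$. Let $\sigma_n>0$, $\beta>0$, $\delta>0$. In each slot $t=1,\dots,T$ a set $\mathcal N_t\subseteq\mathcal N$ of workers is drawn uniformly at random among the sets of a given size $m_t$, where $1\le m_t\le N$, and the entries of a given vector $q_t$ of $m_t$ nonnegative mixing ratios with sum $1$ (for example a realization of a Dirichlet vector; the ratios may be unequal) are assigned to the workers in $\mathcal N_t$ in uniformly random order; write $q_{i,t}$ for the ratio of worker $i\in\mathcal N_t$. What is released in slot $t$ is the pair $$\Big(\sum_{i\in\mathcal N_t}q_{i,t}x_i+\frac{n_{I,t}}{\sqrt\beta},\ \ \sum_{i\in\mathcal N_t}q_{i,t}l_i+\frac{n_{L,t}}{\sqrt\beta}\Big),$$ where $n_{I,t}\sim\mathcal N(0,\tfrac{\sigma_n^2}{2}I_{d_X})$ and $n_{L,t}\sim\mathcal N(0,\tfrac{\sigma_n^2}{2}I_{d_Y})$,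 and all selections, assignments and noises are independent. A mechanism $M$ is $(\epsilon,\delta)$-differentially private if $\mathbb P(M(D)\in S)\le e^{\epsilon}\,\mathbb P(M(D')\in S)+\delta$ for every measurable set $S$ of outcomes and all datasets $D,D'$ one of which arises from the other by removing the sample of one worker. Suppose that the sampling ratio $r=|\mathcal N_t|/|\mathcal N|=m_t/N$ is the same for all $t$. For integers $\gamma,x\ge 0$ put $$\epsilon_t(\gamma)=\frac{\gamma}{2}\cdot\frac{\max_{i\in\mathcal N_t}q_{i,t}^2\,(d_X+d_Y)}{\sigma_n^2/(2\beta)},\qquad C_t(x)=\sum_{i=0}^{x}(-1)^i\binom{x}{i}e^{(i-1)\epsilon_t(i)},$$ and for integers $\gamma\ge2$ $$\epsilon_t'(\gamma)=\frac1{\gamma-1}\ln\Big(1+r^2\binom{\gamma}{2}\min\{4(e^{\epsilon_t(2)}-1),\,2e^{\epsilon_t(2)}\}+4\sum_{j=3}^{\gamma}r^j\binom{\gamma}{j}\sqrt{C_t(2\lfloor j/2\rfloor)\,C_t(2\lceil j/2\rceil)}\Big).$$ Then the minimum $$\epsilon=\min_{\gamma\in\{2,3,\dots\}}\ \sum_{t=1}^{T}\epsilon_t'(\gamma)+\frac{\ln(1/\delta)}{\gamma-1}$$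 exists, and the joint release of the pairs of all slots $t=1,\dots,T$ is $(\epsilon,\delta)$-differentially private. -/

import Mathlib

open MeasureTheory ProbabilityTheory
open scoped ENNReal

noncomputable section

namespace AirMixML

/-- A private training sample: an input vector in `[0,1]^dX` together with a one-hot label in
`{0,1}^dY`. -/
structure Sample (dX dY : ℕ) where
  input : Fin dX → ℝ
  input_mem : ∀ d, input d ∈ Set.Icc (0 : ℝ) 1
  label : Fin dY → ℝ
  label_oneHot : ∃ j, label = Pi.single j 1

/-- A dataset held by `N` workers, at most one sample per worker; `none` means that the data of
this worker has been removed. -/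
abbrev Dataset (N dX dY : ℕ) := Fin N → Option (Sample dX dY)

/-- `D'` is formed from `D` by removing the sample of exactly one worker. -/
def IsRemoval {N dX dY : ℕ} (D D' : Dataset N dX dY) : Prop :=
  ∃ i, (D i).isSome ∧ D' = Function.update D i none

/-- Two datasets are adjacent if one of them is formed by removing one sample from the other. -/
def Adjacent {N dX dY : ℕ} (D D' : Dataset N dX dY) : Prop :=
  IsRemoval D D' ∨ IsRemoval D' D

/-- The input vector contributed by a worker; a removed worker contributes nothing. -/
def inputOf {dX dY : ℕ} (s : Option (Sample dX dY)) : Fin dX → ℝ :=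
  s.elim 0 Sample.input

/-- The label vector contributed by a worker; a removed worker contributes nothing. -/
def labelOf {dX dY : ℕ} (s : Option (Sample dX dY)) : Fin dY → ℝ :=
  s.elim 0 Sample.label

/-- The law `𝒩(0, (σ²/2) I_d)` of the real part of the channel noise. -/
def noise (σ : ℝ) (d : ℕ) : Measure (Fin d → ℝ) :=
  Measure.pi fun _ => gaussianReal 0 (σ ^ 2 / 2).toNNReal

/-- The law of the exposed pair (noisy mixed-up input, noisy mixed-up label) of one slot for a given
schedule `φ`: the scheduled workers are the `m` values of `φ`, and worker `φ k` has the mixing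
ratio `q k`. The two channel noises are independent. -/
def scheduledLaw {N m dX dY : ℕ} (σ β : ℝ) (q : Fin m → ℝ) (D : Dataset N dX dY)
    (φ : Fin m ↪ Fin N) : Measure ((Fin dX → ℝ) × (Fin dY → ℝ)) :=
  ((noise σ dX).prod (noise σ dY)).map fun n =>
    (∑ k, q k • inputOf (D (φ k)) + (√β)⁻¹ • n.1,
     ∑ k, q k • labelOf (D (φ k)) + (√β)⁻¹ • n.2)

/-- The law of the exposed pair of one slot: the schedule is uniform among all injections
`Fin m ↪ Fin N`, that is, a uniformly random `m`-subset of the workers is scheduled and the `m`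
mixing ratios are assigned to its members in uniformly random order. -/
def slotLaw {N m dX dY : ℕ} (σ β : ℝ) (q : Fin m → ℝ) (D : Dataset N dX dY) :
    Measure ((Fin dX → ℝ) × (Fin dY → ℝ)) :=
  (Fintype.card (Fin m ↪ Fin N) : ℝ≥0∞)⁻¹ • ∑ φ : Fin m ↪ Fin N, scheduledLaw σ β q D φ

/-- The randomized mechanism: the joint law of the pairs exposed in all `T` slots, with independent
schedules and noises in different slots, as a function of the dataset. -/
def mechanism {N T dX dY : ℕ} {m : Fin T → ℕ} (σ β : ℝ) (q : (t : Fin T) → Fin (m t) → ℝ)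
    (D : Dataset N dX dY) : Measure (Fin T → (Fin dX → ℝ) × (Fin dY → ℝ)) :=
  Measure.pi fun t => slotLaw σ β (q t) D

/-- `(ε, δ)`-differential privacy of a randomized mechanism, given by the law `M D` of its outcome on
each dataset `D`. -/
def IsDP {N dX dY : ℕ} {Ω : Type*} [MeasurableSpace Ω] (M : Dataset N dX dY → Measure Ω)
    (ε δ : ℝ) : Prop :=
  ∀ D D' : Dataset N dX dY, Adjacent D D' → ∀ S : Set Ω, MeasurableSet S →
    M D S ≤ ENNReal.ofReal (Real.exp ε) * M D' S + ENNReal.ofReal δ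

/-- The Gaussian Rényi bound `ε_t(γ)` of a slot with mixing ratios `q`. -/
def gaussRDP {m : ℕ} (dX dY : ℕ) (σ β : ℝ) (q : Fin m → ℝ) (γ : ℕ) : ℝ :=
  (γ : ℝ) / 2 * (((⨆ k, q k ^ 2) * ((dX : ℝ) + dY)) / (σ ^ 2 / (2 * β)))

/-- `C(x) = ∑_{i=0}^x (-1)^i (x choose i) exp((i-1) ε(i))`. -/
def altSum (ε : ℕ → ℝ) (x : ℕ) : ℝ :=
  ∑ i ∈ Finset.range (x + 1), (-1 : ℝ) ^ i * (x.choose i : ℝ) * Real.exp (((i : ℝ) - 1) * ε i)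

/-- The subsampled Rényi bound `ε'(γ)` for the sampling ratio `r` and the Rényi bounds `ε(·)`. In the
last sum `j / 2` and `(j + 1) / 2` are the floor and the ceiling of half of `j`. -/
def subsampledRDP (r : ℝ) (ε : ℕ → ℝ) (γ : ℕ) : ℝ :=
  1 / ((γ : ℝ) - 1) * Real.log
    (1 + r ^ 2 * (γ.choose 2 : ℝ) * min (4 * (Real.exp (ε 2) - 1)) (2 * Real.exp (ε 2))
      + 4 * ∑ j ∈ Finset.Icc 3 γ, r ^ j * (γ.choose j : ℝ)
          * √(altSum ε (2 * (j / 2)) * altSum ε (2 * ((j + 1) / 2))))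

end AirMixML

end

/-!
The mechanism is private because the Rényi moment `∫ Q (P / Q) ^ γ` of one slot, for the slot laws
`P`, `Q` on two adjacent datasets, is at most `exp ((γ - 1) ε'(γ))`. Such moments multiply over the
independent slots, and Markov's inequality turns the product into `(ε, δ)`-differential privacy
(`pi_withDensity_le_of_moment`).

For one slot let `i₀` be the worker whose sample is removed. Only schedules containing `i₀`
contribute to `P - Q`. A uniform schedule `φ` is coupled with such a schedule by letting `i₀` change
places with the worker in a uniform position of `φ` (`insertAt`, `sum_insertAt`); this is uniform
among the schedules containing `i₀`, and it changes the noiseless output by at most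
`max q` in each coordinate (`abs_sum_insertAt_sub_le`), although the ratios may be unequal. So
`P - Q` is `r` times a mixture of differences `p - q` of Gaussian densities, and `Q` is the mixture
with the same weights of Gaussian densities close to `p` and `q`. By joint convexity of
`|x| ^ j / y ^ (j - 1)` (`sum_mul_abs_div_pow_le`) the binomial expansion of the Rényi moment is
bounded, term by term, by `r ^ j` times the ternary divergences of three Gaussian laws
(`lintegral_mixture_le`).

These in turn reduce to four binary divergences, by distinguishing whether the reference density
lies between the other two (`mul_abs_sub_div_pow_le`). A binary divergence of even order is an
alternating sum of Gaussian exponential moments, and it increases with the distance of the means by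
Jensen's inequality (`sub_one_pow_le_sum`); odd orders follow from the Cauchy-Schwarz inequality.

The minimum over `γ` exists because the alternating sums grow like `exp (x ^ 2 a / 2)`, where
`a > 0` is the normalized squared sensitivity (`exp_le_gaussAlt`), so `ε'(γ)` tends to infinity with `γ`.
-/

open MeasureTheory ProbabilityTheory
open scoped ENNReal NNReal

namespace AirMixML

/-! ### Products of densities, composition of slots, and conversion to approximate privacy -/

/-- The product of finitely many measures with densities has the product of the densities. -/
theorem pi_withDensity {ι : Type*} [Fintype ι] {Z : ι → Type*} [∀ i, MeasurableSpace (Z i)]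
    (μ : (i : ι) → Measure (Z i)) [∀ i, IsProbabilityMeasure (μ i)]
    (f : (i : ι) → Z i → ℝ≥0∞) (hf : ∀ i, Measurable (f i))
    [∀ i, SigmaFinite ((μ i).withDensity (f i))] :
    Measure.pi (fun i => (μ i).withDensity (f i))
      = (Measure.pi μ).withDensity fun z => ∏ i, f i (z i) := by
  refine Measure.pi_eq fun s hs => ?_
  rw [withDensity_apply _ (MeasurableSet.univ_pi hs),
    ← lintegral_indicator (MeasurableSet.univ_pi hs)]
  have h1 : (Set.univ.pi s).indicator (fun z : (i : ι) → Z i => ∏ i, f i (z i))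
      = fun z => ∏ i, (s i).indicator (f i) (z i) := by
    funext z
    by_cases hz : z ∈ Set.univ.pi s
    · rw [Set.indicator_of_mem hz]
      exact Finset.prod_congr rfl fun i _ => (Set.indicator_of_mem (hz i trivial) _).symm
    · rw [Set.indicator_of_notMem hz]
      simp only [Set.mem_pi, Set.mem_univ, forall_const, not_forall] at hz
      obtain ⟨i, hi⟩ := hz
      exact (Finset.prod_eq_zero (Finset.mem_univ i) (Set.indicator_of_notMem hi _)).symm
  rw [h1]
  have h2 := lintegral_prod_eq_prod_lintegral_of_indepFun (μ := Measure.pi μ) Finset.univ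
    (fun i z => (s i).indicator (f i) (z i))
    (iIndepFun_pi (X := fun i => (s i).indicator (f i))
      fun i => ((hf i).indicator (hs i)).aemeasurable)
    fun i => ((hf i).indicator (hs i)).comp (measurable_pi_apply i)
  rw [h2]
  refine Finset.prod_congr rfl fun i _ => ?_
  rw [withDensity_apply _ (hs i), ← lintegral_indicator (hs i)]
  exact (measurePreserving_eval μ i).lintegral_comp ((hf i).indicator (hs i))

/-- The pointwise inequality behind the passage from Rényi to approximate differential privacy:
where the likelihood ratio `L` exceeds `e ^ ε`, it is at most `L ^ γ e ^ (-(γ - 1) ε)`. -/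
theorem le_exp_add_pow_mul (L : ℝ≥0∞) (ε : ℝ) {γ : ℕ} (hγ : 1 ≤ γ) :
    L ≤ ENNReal.ofReal (Real.exp ε)
      + L ^ γ * ENNReal.ofReal (Real.exp (-((γ - 1 : ℕ) : ℝ) * ε)) := by
  rcases le_total L (ENNReal.ofReal (Real.exp ε)) with h | h
  · exact h.trans le_self_add
  · refine le_trans ?_ le_add_self
    obtain ⟨k, rfl⟩ : ∃ k, γ = k + 1 := ⟨γ - 1, by omega⟩
    simp only [Nat.add_sub_cancel]
    have : (1 : ℝ≥0∞) ≤ L ^ k * ENNReal.ofReal (Real.exp (-(k : ℝ) * ε)) := by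
      calc (1 : ℝ≥0∞) = ENNReal.ofReal (Real.exp ε) ^ k
            * ENNReal.ofReal (Real.exp (-(k : ℝ) * ε)) := by
            rw [← ENNReal.ofReal_pow (Real.exp_pos _).le, ← ENNReal.ofReal_mul (by positivity),
              ← Real.exp_nat_mul, ← Real.exp_add]
            simp
        _ ≤ _ := by gcongr
    calc L = L * 1 := (mul_one _).symm
      _ ≤ L * (L ^ k * ENNReal.ofReal (Real.exp (-(k : ℝ) * ε))) := by gcongr
      _ = _ := by ring

/-- Composition of Rényi bounds over independent slots followed by the conversion to
`(ε, δ)`-indistinguishability: `L t` is the likelihood ratio of slot `t`, and its moment of order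
`γ` is at most `e ^ ((γ - 1) ρ t)`. -/
theorem pi_withDensity_le_of_moment {ι : Type*} [Fintype ι] {Z : ι → Type*}
    [∀ i, MeasurableSpace (Z i)] (Q : (i : ι) → Measure (Z i)) [∀ i, IsProbabilityMeasure (Q i)]
    (L : (i : ι) → Z i → ℝ≥0∞) (hL : ∀ i, Measurable (L i))
    [∀ i, SigmaFinite ((Q i).withDensity (L i))] {γ : ℕ} (hγ : 2 ≤ γ) (ρ : ι → ℝ)
    (hρ : ∀ i, ∫⁻ z, L i z ^ γ ∂(Q i) ≤ ENNReal.ofReal (Real.exp (((γ : ℝ) - 1) * ρ i)))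
    {δ : ℝ} (hδ : 0 < δ) (S : Set ((i : ι) → Z i)) (hS : MeasurableSet S) :
    Measure.pi (fun i => (Q i).withDensity (L i)) S
      ≤ ENNReal.ofReal (Real.exp ((∑ i, ρ i) + Real.log (1 / δ) / ((γ : ℝ) - 1)))
          * Measure.pi Q S + ENNReal.ofReal δ := by
  rw [pi_withDensity Q L hL, withDensity_apply _ hS]
  set ε := (∑ i, ρ i) + Real.log (1 / δ) / ((γ : ℝ) - 1) with hε
  have hγ' : ((γ - 1 : ℕ) : ℝ) = (γ : ℝ) - 1 := by
    rw [Nat.cast_sub (by omega)]; simp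
  have hγ0 : (γ : ℝ) - 1 ≠ 0 := by
    have : (2 : ℝ) ≤ γ := by exact_mod_cast hγ
    linarith
  have hmeas : Measurable fun z : (i : ι) → Z i => (∏ i, L i (z i)) ^ γ := by
    refine Measurable.pow_const (Finset.measurable_fun_prod _ fun i _ => ?_) _
    exact (hL i).comp (measurable_pi_apply i)
  have hmom : ∫⁻ z, (∏ i, L i (z i)) ^ γ ∂(Measure.pi Q)
      ≤ ENNReal.ofReal (Real.exp (((γ : ℝ) - 1) * ∑ i, ρ i)) := by
    simp_rw [← Finset.prod_pow]
    have h2 := lintegral_prod_eq_prod_lintegral_of_indepFun (μ := Measure.pi Q) Finset.univ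
      (fun i z => L i (z i) ^ γ)
      (iIndepFun_pi (X := fun i z => L i z ^ γ) fun i => ((hL i).pow_const _).aemeasurable)
      fun i => ((hL i).pow_const _).comp (measurable_pi_apply i)
    rw [h2, Finset.mul_sum, Real.exp_sum,
      ENNReal.ofReal_prod_of_nonneg fun i _ => (Real.exp_pos _).le]
    refine Finset.prod_le_prod' fun i _ => ?_
    rw [(measurePreserving_eval Q i).lintegral_comp (f := fun z => L i z ^ γ) ((hL i).pow_const _)]
    exact hρ i
  calc ∫⁻ z in S, ∏ i, L i (z i) ∂(Measure.pi Q)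
      ≤ ∫⁻ z in S, (ENNReal.ofReal (Real.exp ε)
          + (∏ i, L i (z i)) ^ γ * ENNReal.ofReal (Real.exp (-((γ - 1 : ℕ) : ℝ) * ε)))
            ∂(Measure.pi Q) :=
        lintegral_mono fun z => le_exp_add_pow_mul _ _ (by omega)
    _ = ENNReal.ofReal (Real.exp ε) * Measure.pi Q S
          + (∫⁻ z in S, (∏ i, L i (z i)) ^ γ ∂(Measure.pi Q))
            * ENNReal.ofReal (Real.exp (-((γ - 1 : ℕ) : ℝ) * ε)) := by
        rw [lintegral_add_left measurable_const, lintegral_mul_const _ hmeas, setLIntegral_const]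
    _ ≤ ENNReal.ofReal (Real.exp ε) * Measure.pi Q S
          + ENNReal.ofReal (Real.exp (((γ : ℝ) - 1) * ∑ i, ρ i))
            * ENNReal.ofReal (Real.exp (-((γ - 1 : ℕ) : ℝ) * ε)) := by
        gcongr
        exact (setLIntegral_le_lintegral _ _).trans hmom
    _ = _ := by
        rw [← ENNReal.ofReal_mul (Real.exp_pos _).le, ← Real.exp_add, hγ', hε]
        congr 2
        have : ((γ : ℝ) - 1) * ∑ i, ρ i + -((γ : ℝ) - 1)
            * ((∑ i, ρ i) + Real.log (1 / δ) / ((γ : ℝ) - 1)) = Real.log δ := by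
          rw [one_div, Real.log_inv]; field_simp; ring
        rw [this, Real.exp_log hδ]

/-! ### Moments of the likelihood ratio of two Gaussian laws -/

theorem sub_one_pow_eq_sum {x : ℕ} (hx : Even x) (y : ℝ) :
    (y - 1) ^ x = ∑ i ∈ Finset.range (x + 1), (-1 : ℝ) ^ i * (x.choose i : ℝ) * y ^ i := by
  rw [← hx.neg_pow, show -(y - 1) = -y + 1 by ring, add_pow]
  refine Finset.sum_congr rfl fun i _ => ?_
  rw [neg_pow y]; ring

/-- The moments of a log-normal variable of mean one and log-variance `b`. -/
theorem lognormal_moment (b : NNReal) (i : ℕ) :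
    Integrable (fun w => Real.exp (w - b / 2) ^ i) (gaussianReal 0 b) ∧
      ∫ w, Real.exp (w - b / 2) ^ i ∂(gaussianReal 0 b)
        = Real.exp (((i : ℝ) - 1) * (i / 2 * b)) := by
  have h : (fun w : ℝ => Real.exp (w - b / 2) ^ i)
      = fun w => Real.exp (i * w) * Real.exp (-(i * (b / 2))) := by
    funext w
    rw [← Real.exp_nat_mul, ← Real.exp_add]
    congr 1; ring
  rw [h]
  refine ⟨(integrable_exp_mul_gaussianReal _).mul_const _, ?_⟩
  have h2 : ∫ w, Real.exp (i * w) ∂(gaussianReal 0 b) = Real.exp (b * i ^ 2 / 2) := by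
    have := congrFun (mgf_fun_id_gaussianReal (μ := 0) (v := b)) (i : ℝ)
    simpa [mgf] using this
  rw [integral_mul_const, h2, ← Real.exp_add]
  congr 1; ring

theorem lognormal_sub_one_pow {x : ℕ} (hx : Even x) (b : NNReal) (u : ℝ) :
    Integrable (fun w => (u * Real.exp (w - b / 2) - 1) ^ x) (gaussianReal 0 b) ∧
      ∫ w, (u * Real.exp (w - b / 2) - 1) ^ x ∂(gaussianReal 0 b)
        = ∑ i ∈ Finset.range (x + 1), (-1 : ℝ) ^ i * (x.choose i : ℝ)
            * (Real.exp (((i : ℝ) - 1) * (i / 2 * b)) * u ^ i) := by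
  have hpow : (fun w => (u * Real.exp (w - b / 2) - 1) ^ x) = fun w =>
      ∑ i ∈ Finset.range (x + 1),
        (-1 : ℝ) ^ i * (x.choose i : ℝ) * u ^ i * Real.exp (w - b / 2) ^ i := by
    funext w
    rw [sub_one_pow_eq_sum hx]
    exact Finset.sum_congr rfl fun i _ => by rw [mul_pow]; ring
  rw [hpow]
  refine ⟨integrable_finsetSum _ fun i _ => (lognormal_moment b i).1.const_mul _, ?_⟩
  rw [integral_finsetSum _ fun i _ => (lognormal_moment b i).1.const_mul _]
  refine Finset.sum_congr rfl fun i _ => ?_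
  rw [integral_const_mul, (lognormal_moment b i).2]; ring

/-- An even power of `u - 1` increases in mean when `u` is multiplied by an independent log-normal
variable of mean one; the right-hand side is that mean, for log-variance `b`. -/
theorem sub_one_pow_le_sum {x : ℕ} (hx : Even x) {b : ℝ} (hb : 0 ≤ b) (u : ℝ) :
    (u - 1) ^ x ≤ ∑ i ∈ Finset.range (x + 1),
      (-1 : ℝ) ^ i * (x.choose i : ℝ) * (Real.exp (((i : ℝ) - 1) * (i / 2 * b)) * u ^ i) := by
  lift b to NNReal using hb
  obtain ⟨hint, heq⟩ := lognormal_sub_one_pow hx b u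
  have h1 := lognormal_moment b 1
  simp only [pow_one, Nat.cast_one, sub_self, zero_mul, Real.exp_zero] at h1
  have hJ := (hx.convexOn_pow (𝕜 := ℝ)).map_integral_le (μ := gaussianReal 0 b)
    (f := fun w => u * Real.exp (w - b / 2) - 1)
    (by fun_prop) isClosed_univ (by simp) ((h1.1.const_mul u).sub (integrable_const _)) hint
  rw [heq, integral_sub (h1.1.const_mul u) (integrable_const _), integral_const_mul, h1.2] at hJ
  simpa using hJ

/-- `p` and `r` are positive densities with respect to `ν` whose likelihood ratio has, under `r`,
the moments of a log-normal variable of mean one and log-variance at most `a`: this is the situation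
of two Gaussian laws of equal covariance whose means have normalized squared distance at most `a`. -/
structure RatioMoments {Z : Type*} [MeasurableSpace Z] (ν : Measure Z) (a : ℝ) (p r : Z → ℝ) :
    Prop where
  left_pos : ∀ z, 0 < p z
  right_pos : ∀ z, 0 < r z
  left_meas : Measurable p
  right_meas : Measurable r
  moment : ∃ a' ≤ a, ∀ i : ℕ, Integrable (fun z => r z * (p z / r z) ^ i) ν ∧
    ∫ z, r z * (p z / r z) ^ i ∂ν = Real.exp (((i : ℝ) - 1) * (i / 2 * a'))

/-- The alternating sum of `altSum` for the Gaussian Rényi bounds `i ↦ i a / 2`. For even `x` it is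
the moment of order `x` of `M - 1`, where `M` is log-normal of mean one and log-variance `a`. -/
noncomputable def gaussAlt (a : ℝ) (x : ℕ) : ℝ := altSum (fun i => (i : ℝ) / 2 * a) x

namespace RatioMoments

variable {Z : Type*} [MeasurableSpace Z] {ν : Measure Z} {a : ℝ} {p q r : Z → ℝ}

theorem integrable_even (h : RatioMoments ν a p r) {x : ℕ} (hx : Even x) :
    Integrable (fun z => r z * (p z / r z - 1) ^ x) ν := by
  obtain ⟨a', -, hm⟩ := h.moment
  simp_rw [sub_one_pow_eq_sum hx, Finset.mul_sum]
  refine integrable_finsetSum _ fun i _ => ?_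
  refine ((hm i).1.const_mul ((-1 : ℝ) ^ i * (x.choose i : ℝ))).congr (.of_forall fun z => ?_)
  simp only; ring

theorem integral_even_le (h : RatioMoments ν a p r) {x : ℕ} (hx : Even x) :
    ∫ z, r z * (p z / r z - 1) ^ x ∂ν ≤ gaussAlt a x := by
  obtain ⟨a', ha', hm⟩ := h.moment
  -- raising the log-variance from `a'` to `a` multiplies the moment of order `i` by
  -- `exp ((i - 1) * (i / 2 * (a - a')))`, which can only increase the alternating sum
  set c : ℕ → ℝ := fun i =>
    (-1 : ℝ) ^ i * (x.choose i : ℝ) * Real.exp (((i : ℝ) - 1) * (i / 2 * (a - a'))) with hc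
  have hle : ∀ z, r z * (p z / r z - 1) ^ x
      ≤ ∑ i ∈ Finset.range (x + 1), c i * (r z * (p z / r z) ^ i) := by
    intro z
    refine (mul_le_mul_of_nonneg_left (sub_one_pow_le_sum hx (sub_nonneg.2 ha') _)
      (h.right_pos z).le).trans_eq ?_
    rw [Finset.mul_sum]
    exact Finset.sum_congr rfl fun i _ => by rw [hc]; ring
  refine (integral_mono (h.integrable_even hx)
    (integrable_finsetSum _ fun i _ => (hm i).1.const_mul _) hle).trans_eq ?_
  rw [integral_finsetSum _ fun i _ => (hm i).1.const_mul _]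
  refine Finset.sum_congr rfl fun i _ => ?_
  rw [integral_const_mul, (hm i).2, hc, mul_assoc, ← Real.exp_add]
  congr 2; ring

theorem gaussAlt_nonneg (h : RatioMoments ν a p r) {x : ℕ} (hx : Even x) : 0 ≤ gaussAlt a x :=
  (integral_nonneg fun z => mul_nonneg (h.right_pos z).le (hx.pow_nonneg _)).trans
    (h.integral_even_le hx)

/-- An odd order `j` is split as `⌊j / 2⌋ + ⌈j / 2⌉` by the Cauchy-Schwarz inequality. -/
theorem abs_pow (h : RatioMoments ν a p r) (j : ℕ) :
    Integrable (fun z => r z * |p z / r z - 1| ^ j) ν ∧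
      ∫ z, r z * |p z / r z - 1| ^ j ∂ν
        ≤ √(gaussAlt a (2 * (j / 2)) * gaussAlt a (2 * ((j + 1) / 2))) := by
  have hp := h.left_meas
  have hr := h.right_meas
  set f : ℕ → Z → ℝ := fun k z => √(r z) * |p z / r z - 1| ^ k with hf
  have hfm : ∀ k, Measurable (f k) := fun k => by fun_prop
  have hf0 : ∀ k z, 0 ≤ f k z := fun k z => by positivity
  have hsq : ∀ k, (fun z => f k z ^ 2) = fun z => r z * (p z / r z - 1) ^ (2 * k) := by
    intro k; funext z
    rw [hf, mul_pow, Real.sq_sqrt (h.right_pos z).le, ← pow_mul, mul_comm k 2, pow_mul, sq_abs,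
      ← pow_mul]
  have hL : ∀ k, MemLp (f k) 2 ν := fun k => by
    rw [memLp_two_iff_integrable_sq (hfm k).aestronglyMeasurable, hsq]
    exact h.integrable_even (even_two_mul k)
  have hprod : (fun z => r z * |p z / r z - 1| ^ j)
      = fun z => f (j / 2) z * f ((j + 1) / 2) z := by
    funext z
    have : |p z / r z - 1| ^ j = |p z / r z - 1| ^ (j / 2) * |p z / r z - 1| ^ ((j + 1) / 2) := by
      rw [← pow_add]; congr 1; omega
    rw [this]
    nth_rewrite 1 [← Real.mul_self_sqrt (h.right_pos z).le]
    rw [hf]; ring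
  rw [hprod]
  refine ⟨(hL _).integrable_mul (hL _), ?_⟩
  have hH := integral_mul_le_Lp_mul_Lq_of_nonneg (μ := ν) Real.HolderConjugate.two_two
    (.of_forall (hf0 (j / 2))) (.of_forall (hf0 ((j + 1) / 2)))
    (by simpa using hL (j / 2)) (by simpa using hL ((j + 1) / 2))
  refine hH.trans ?_
  simp only [Real.rpow_two, hsq, ← Real.sqrt_eq_rpow]
  rw [Real.sqrt_mul (h.gaussAlt_nonneg (even_two_mul _))]
  exact mul_le_mul (Real.sqrt_le_sqrt (h.integral_even_le (even_two_mul _)))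
    (Real.sqrt_le_sqrt (h.integral_even_le (even_two_mul _))) (Real.sqrt_nonneg _)
    (Real.sqrt_nonneg _)

theorem integral_sq_le (h : RatioMoments ν a p r) :
    Integrable (fun z => r z * (p z / r z) ^ 2) ν ∧
      ∫ z, r z * (p z / r z) ^ 2 ∂ν ≤ Real.exp a := by
  obtain ⟨a', ha', hm⟩ := h.moment
  refine ⟨(hm 2).1, (hm 2).2.trans_le (Real.exp_le_exp.2 ?_)⟩
  norm_num
  linarith

end RatioMoments

theorem gaussAlt_two (a : ℝ) : gaussAlt a 2 = Real.exp a - 1 := by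
  simp [gaussAlt, altSum, Finset.sum_range_succ]
  norm_num
  ring_nf

/-- If `r` lies outside the interval between `p` and `q`, then `|p - q|` is at most `|p - r|` or
`|q - r|`; if it lies inside, then `r` is at least the smaller one of `p` and `q`. -/
theorem mul_abs_sub_div_pow_le {p q r : ℝ} (hp : 0 < p) (hq : 0 < q) (hr : 0 < r) {j : ℕ}
    (hj : 1 ≤ j) :
    r * |(p - q) / r| ^ j ≤ r * |p / r - 1| ^ j + r * |q / r - 1| ^ j
      + (p * |q / p - 1| ^ j + q * |p / q - 1| ^ j) := by
  obtain ⟨k, rfl⟩ : ∃ k, j = k + 1 := ⟨j - 1, by omega⟩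
  have key : ∀ s t : ℝ, 0 < t → t * |s / t| ^ (k + 1) = |s| ^ (k + 1) / t ^ k := by
    intro s t ht
    rw [abs_div, abs_of_pos ht, div_pow, pow_succ t]
    field_simp
  have e : ∀ s t : ℝ, 0 < t → s / t - 1 = (s - t) / t := fun s t ht => by field_simp
  rw [e p r hr, e q r hr, e q p hp, e p q hq, key _ _ hr, key _ _ hr, key _ _ hr, key _ _ hp,
    key _ _ hq]
  have n1 : 0 ≤ |p - r| ^ (k + 1) / r ^ k := by positivity
  have n2 : 0 ≤ |q - r| ^ (k + 1) / r ^ k := by positivity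
  have n3 : 0 ≤ |q - p| ^ (k + 1) / p ^ k := by positivity
  have n4 : 0 ≤ |p - q| ^ (k + 1) / q ^ k := by positivity
  by_cases h1 : p ≤ r
  · have : |p - q| ^ (k + 1) / r ^ k ≤ |q - p| ^ (k + 1) / p ^ k := by
      rw [abs_sub_comm]; gcongr
    linarith
  by_cases h2 : q ≤ r
  · have : |p - q| ^ (k + 1) / r ^ k ≤ |p - q| ^ (k + 1) / q ^ k := by gcongr
    linarith
  push Not at h1 h2
  rcases le_total p q with h3 | h3
  · have habs : |p - q| ≤ |q - r| := by
      rw [abs_sub_comm, abs_of_nonneg (by linarith), abs_of_nonneg (by linarith)]; linarith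
    have : |p - q| ^ (k + 1) / r ^ k ≤ |q - r| ^ (k + 1) / r ^ k := by gcongr
    linarith
  · have habs : |p - q| ≤ |p - r| := by
      rw [abs_of_nonneg (by linarith), abs_of_nonneg (by linarith)]; linarith
    have : |p - q| ^ (k + 1) / r ^ k ≤ |p - r| ^ (k + 1) / r ^ k := by gcongr
    linarith

/-- `RatioMoments` for those ordered pairs among three densities that bound the ternary divergence
of `p`, `q` relative to `r`; the divergences of `r` relative to `p` or `q` are not needed. -/
structure TernaryMoments {Z : Type*} [MeasurableSpace Z] (ν : Measure Z) (a : ℝ)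
    (p q r : Z → ℝ) : Prop where
  pr : RatioMoments ν a p r
  qr : RatioMoments ν a q r
  pq : RatioMoments ν a p q
  qp : RatioMoments ν a q p

namespace TernaryMoments

variable {Z : Type*} [MeasurableSpace Z] {ν : Measure Z} {a : ℝ} {p q r : Z → ℝ}

theorem abs_pow (h : TernaryMoments ν a p q r) {j : ℕ} (hj : 1 ≤ j) :
    Integrable (fun z => r z * |(p z - q z) / r z| ^ j) ν ∧
      ∫ z, r z * |(p z - q z) / r z| ^ j ∂ν
        ≤ 4 * √(gaussAlt a (2 * (j / 2)) * gaussAlt a (2 * ((j + 1) / 2))) := by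
  have hpm := h.pr.left_meas
  have hqm := h.qr.left_meas
  have hrm := h.pr.right_meas
  have i1 := h.pr.abs_pow j
  have i2 := h.qr.abs_pow j
  have i3 := h.qp.abs_pow j
  have i4 := h.pq.abs_pow j
  have hle := fun z => mul_abs_sub_div_pow_le (h.pr.left_pos z) (h.qr.left_pos z)
    (h.pr.right_pos z) hj
  have hint := (i1.1.add i2.1).add (i3.1.add i4.1)
  have hI : Integrable (fun z => r z * |(p z - q z) / r z| ^ j) ν := by
    refine hint.mono' (by fun_prop) (.of_forall fun z => ?_)
    have := (h.pr.right_pos z).le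
    rw [Real.norm_of_nonneg (by positivity)]
    exact hle z
  refine ⟨hI, (integral_mono hI hint hle).trans ?_⟩
  rw [integral_add' (i1.1.add i2.1) (i3.1.add i4.1), integral_add' i1.1 i2.1,
    integral_add' i3.1 i4.1]
  linarith [i1.2, i2.2, i3.2, i4.2]

theorem integral_sq_le (h : TernaryMoments ν a p q r) :
    ∫ z, r z * |(p z - q z) / r z| ^ 2 ∂ν
      ≤ min (4 * (Real.exp a - 1)) (2 * Real.exp a) := by
  have hI := (h.abs_pow (j := 2) (by norm_num)).1
  refine le_min ?_ ?_
  · have i1 := h.pr.abs_pow 2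
    have i2 := h.qr.abs_pow 2
    have e1 := h.pr.integral_even_le even_two
    have e2 := h.qr.integral_even_le even_two
    simp only [sq_abs] at i1 i2
    refine (integral_mono hI ((i1.1.add i2.1).const_mul 2) fun z => ?_).trans ?_
    · have hr := h.pr.right_pos z
      simp only [sq_abs, Pi.add_apply]
      rw [show (p z - q z) / r z = (p z / r z - 1) - (q z / r z - 1) by ring]
      nlinarith [mul_nonneg hr.le (sq_nonneg ((p z / r z - 1) + (q z / r z - 1)))]
    · rw [integral_const_mul, integral_add' i1.1 i2.1]
      rw [gaussAlt_two] at e1 e2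
      linarith
  · have i1 := h.pr.integral_sq_le
    have i2 := h.qr.integral_sq_le
    refine (integral_mono hI (i1.1.add i2.1) fun z => ?_).trans ?_
    · have hr := h.pr.right_pos z
      have hp := div_pos (h.pr.left_pos z) hr
      have hq := div_pos (h.qr.left_pos z) hr
      simp only [sq_abs, Pi.add_apply]
      rw [sub_div]
      nlinarith [mul_pos hr (mul_pos hp hq)]
    · rw [integral_add' i1.1 i2.1]
      linarith [i1.2, i2.2]

end TernaryMoments

/-- Comparison of `M ^ x` with `(M - 1) ^ x` for a log-normal `M`: the alternating sums grow as fast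
as the moments `e ^ (x (x - 1) a / 2)` themselves, up to a factor `2 ^ x`. -/
theorem exp_le_gaussAlt {a : ℝ} (ha : 0 ≤ a) {x : ℕ} (hx : Even x) :
    Real.exp (((x : ℝ) - 1) * (x / 2 * a)) ≤ 2 ^ x * (gaussAlt a x + 1) := by
  lift a to NNReal using ha
  obtain ⟨hint, heq⟩ := lognormal_sub_one_pow hx a 1
  simp only [one_mul, one_pow, mul_one] at hint heq
  have hle : ∀ w : ℝ, Real.exp (w - a / 2) ^ x ≤ 2 ^ x * ((Real.exp (w - a / 2) - 1) ^ x + 1) := by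
    intro w
    set y := Real.exp (w - a / 2)
    have h1 : 0 ≤ (y - 1) ^ x := hx.pow_nonneg _
    have hy : 0 ≤ y := (Real.exp_pos _).le
    have h2 : (0 : ℝ) < 2 ^ x := by positivity
    rcases le_total y 2 with h | h
    · have : y ^ x ≤ 2 ^ x := by gcongr
      nlinarith
    · have : y ^ x ≤ (2 * (y - 1)) ^ x := by
        gcongr; linarith
      rw [mul_pow] at this
      nlinarith
  have := integral_mono (lognormal_moment a x).1 ((hint.add (integrable_const 1)).const_mul _) hle
  rw [(lognormal_moment a x).2, integral_const_mul, integral_add' hint (integrable_const 1),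
    heq] at this
  simpa [gaussAlt, altSum] using this

theorem eventually_pow_le_gaussAlt {a : ℝ} (ha : 0 < a) {K : ℝ} (hK : 0 ≤ K) :
    ∃ X : ℕ, ∀ x, X ≤ x → Even x → K ^ x ≤ gaussAlt a x := by
  obtain ⟨X, hX⟩ := exists_nat_ge (2 * (2 * (K + 1)) / a + 1)
  refine ⟨X + 1, fun x hx hxe => ?_⟩
  have h1 : 2 * (K + 1) ≤ Real.exp (((x : ℝ) - 1) * (a / 2)) := by
    have hXx : (X : ℝ) ≤ x := by exact_mod_cast (by omega : X ≤ x)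
    have h2 : 2 * (2 * (K + 1)) / a ≤ (x : ℝ) - 1 := by linarith
    rw [div_le_iff₀ ha] at h2
    linarith [Real.add_one_le_exp (((x : ℝ) - 1) * (a / 2))]
  have h2 : (2 * (K + 1)) ^ x ≤ Real.exp (((x : ℝ) - 1) * (x / 2 * a)) := by
    rw [show ((x : ℝ) - 1) * (x / 2 * a) = x * (((x : ℝ) - 1) * (a / 2)) by ring, Real.exp_nat_mul]
    gcongr
  have h3 := h2.trans (exp_le_gaussAlt ha.le hxe)
  rw [mul_pow] at h3
  have h4 := le_of_mul_le_mul_left h3 (by positivity)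
  have h5 := pow_add_pow_le hK zero_le_one (by omega : x ≠ 0)
  rw [one_pow] at h5
  linarith

/-! ### Amplification by subsampling -/

/-- Joint convexity of `(x, y) ↦ y |x / y| ^ j`. -/
theorem sum_mul_abs_div_pow_le {ι : Type*} [Fintype ι] (w x y : ι → ℝ) (hw : ∀ i, 0 ≤ w i)
    (hy : ∀ i, 0 < y i) (hY : 0 < ∑ i, w i * y i) (j : ℕ) :
    (∑ i, w i * y i) * |(∑ i, w i * x i) / ∑ i, w i * y i| ^ j
      ≤ ∑ i, w i * (y i * |x i / y i| ^ j) := by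
  set Y := ∑ i, w i * y i with hYdef
  have h1 : |(∑ i, w i * x i) / Y| ≤ ∑ i, (w i * y i / Y) * |x i / y i| := by
    rw [Finset.sum_div]
    refine (Finset.abs_sum_le_sum_abs _ _).trans_eq (Finset.sum_congr rfl fun i _ => ?_)
    have h0 : 0 ≤ w i * y i / Y := div_nonneg (mul_nonneg (hw i) (hy i).le) hY.le
    have := (hy i).ne'
    have e : w i * x i / Y = w i * y i / Y * (x i / y i) := by field_simp
    rw [e, abs_mul, abs_of_nonneg h0]
  have h2 := Real.pow_arith_mean_le_arith_mean_pow Finset.univ (fun i => w i * y i / Y)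
    (fun i => |x i / y i|) (fun i _ => div_nonneg (mul_nonneg (hw i) (hy i).le) hY.le)
    (by rw [← Finset.sum_div, ← hYdef, div_self hY.ne']) (fun i _ => abs_nonneg _) j
  calc Y * |(∑ i, w i * x i) / Y| ^ j ≤ Y * ∑ i, (w i * y i / Y) * |x i / y i| ^ j := by
        gcongr
        exact (pow_le_pow_left₀ (abs_nonneg _) h1 j).trans h2
    _ = _ := by
        rw [Finset.mul_sum]
        refine Finset.sum_congr rfl fun i _ => ?_
        field_simp

theorem sum_range_succ_eq_add_sum_Icc {γ : ℕ} (hγ : 2 ≤ γ) (f : ℕ → ℝ) :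
    ∑ j ∈ Finset.range (γ + 1), f j = f 0 + f 1 + f 2 + ∑ j ∈ Finset.Icc 3 γ, f j := by
  rw [Finset.range_eq_Ico, Finset.sum_eq_sum_Ico_succ_bot (by omega),
    Finset.sum_eq_sum_Ico_succ_bot (by omega), Finset.sum_eq_sum_Ico_succ_bot (by omega),
    Finset.Ico_add_one_right_eq_Icc]
  ring

/-- The binomial expansion of the Rényi moment `Q (P / Q) ^ γ` around `P = Q`. -/
theorem mul_div_pow_le {P Q : ℝ} (hQ : 0 < Q) {γ : ℕ} (hγ : 2 ≤ γ) :
    Q * (P / Q) ^ γ ≤ Q + γ * (P - Q) + (γ.choose 2 * (Q * |(P - Q) / Q| ^ 2)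
      + ∑ j ∈ Finset.Icc 3 γ, (γ.choose j : ℝ) * (Q * |(P - Q) / Q| ^ j)) := by
  have e : P / Q = (P - Q) / Q + 1 := by field_simp; ring
  rw [e, add_pow, sum_range_succ_eq_add_sum_Icc hγ]
  simp only [one_pow, mul_one, pow_zero, Nat.choose_zero_right, Nat.cast_one, pow_one,
    Nat.choose_one_right, sq_abs]
  rw [mul_add, mul_add, mul_add, Finset.mul_sum]
  have h1 : Q * ((P - Q) / Q * γ) = γ * (P - Q) := by field_simp
  have h2 : ∑ j ∈ Finset.Icc 3 γ, Q * (((P - Q) / Q) ^ j * (γ.choose j : ℝ))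
      ≤ ∑ j ∈ Finset.Icc 3 γ, (γ.choose j : ℝ) * (Q * |(P - Q) / Q| ^ j) := by
    refine Finset.sum_le_sum fun j _ => ?_
    have := (le_abs_self _).trans_eq (abs_pow ((P - Q) / Q) j)
    calc Q * (((P - Q) / Q) ^ j * (γ.choose j : ℝ))
        ≤ Q * (|(P - Q) / Q| ^ j * (γ.choose j : ℝ)) := by gcongr
      _ = _ := by ring
  linarith

/-- The argument of the logarithm in `subsampledRDP`, for the Gaussian Rényi bounds. -/
noncomputable def subsampledSum (s a : ℝ) (γ : ℕ) : ℝ :=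
  1 + s ^ 2 * (γ.choose 2 : ℝ) * min (4 * (Real.exp a - 1)) (2 * Real.exp a)
    + 4 * ∑ j ∈ Finset.Icc 3 γ, s ^ j * (γ.choose j : ℝ)
        * √(gaussAlt a (2 * (j / 2)) * gaussAlt a (2 * ((j + 1) / 2)))

theorem subsampledRDP_eq (s a : ℝ) (γ : ℕ) :
    subsampledRDP s (fun i => (i : ℝ) / 2 * a) γ
      = 1 / ((γ : ℝ) - 1) * Real.log (subsampledSum s a γ) := by
  simp [subsampledRDP, subsampledSum, gaussAlt]

theorem one_le_subsampledSum {s a : ℝ} (hs : 0 ≤ s) (ha : 0 ≤ a) (γ : ℕ) :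
    1 ≤ subsampledSum s a γ := by
  have h1 : 0 ≤ min (4 * (Real.exp a - 1)) (2 * Real.exp a) :=
    le_min (by linarith [Real.one_le_exp ha]) (by positivity)
  unfold subsampledSum
  have : 0 ≤ ∑ j ∈ Finset.Icc 3 γ, s ^ j * (γ.choose j : ℝ)
        * √(gaussAlt a (2 * (j / 2)) * gaussAlt a (2 * ((j + 1) / 2))) :=
    Finset.sum_nonneg fun j _ => by positivity
  have : 0 ≤ s ^ 2 * (γ.choose 2 : ℝ) * min (4 * (Real.exp a - 1)) (2 * Real.exp a) := by
    positivity
  linarith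

theorem exp_mul_subsampledRDP {s a : ℝ} (hs : 0 ≤ s) (ha : 0 ≤ a) {γ : ℕ} (hγ : 2 ≤ γ) :
    Real.exp (((γ : ℝ) - 1) * subsampledRDP s (fun i => (i : ℝ) / 2 * a) γ)
      = subsampledSum s a γ := by
  have : (2 : ℝ) ≤ γ := by exact_mod_cast hγ
  rw [subsampledRDP_eq, ← mul_assoc, mul_one_div_cancel (by linarith), one_mul,
    Real.exp_log (by linarith [one_le_subsampledSum hs ha γ])]

/-- Privacy amplification by subsampling. If `P - Q` is `s` times a mixture of differences
`p i - q i`, and `Q` is the mixture, with the same weights, of densities `r i` such that `p i`,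
`q i`, `r i` are pairwise close, then the Rényi moment of `P` relative to `Q` is bounded by the
subsampled bound for the sampling ratio `s`. -/
theorem lintegral_mixture_le {Z : Type*} [MeasurableSpace Z] {ν : Measure Z} {ι : Type*}
    [Fintype ι] {w : ι → ℝ} (hw : ∀ i, 0 ≤ w i) (hw1 : ∑ i, w i = 1) {p q r : ι → Z → ℝ} {a s : ℝ}
    (hs : 0 ≤ s) (ha : 0 ≤ a) (h : ∀ i, TernaryMoments ν a (p i) (q i) (r i)) {P Q : Z → ℝ}
    (hQ : ∀ z, Q z = ∑ i, w i * r i z) (hPQ : ∀ z, P z - Q z = s * ∑ i, w i * (p i z - q i z))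
    (hQpos : ∀ z, 0 < Q z) (hPpos : ∀ z, 0 < P z) (hQi : Integrable Q ν) (hPi : Integrable P ν)
    (hQ1 : ∫ z, Q z ∂ν = 1) (hP1 : ∫ z, P z ∂ν = 1) {γ : ℕ} (hγ : 2 ≤ γ) :
    ∫⁻ z, ENNReal.ofReal (Q z) * ENNReal.ofReal (P z / Q z) ^ γ ∂ν
      ≤ ENNReal.ofReal (Real.exp
          (((γ : ℝ) - 1) * subsampledRDP s (fun i => (i : ℝ) / 2 * a) γ)) := by
  rw [exp_mul_subsampledRDP hs ha hγ]
  set D : ℕ → Z → ℝ := fun j z => ∑ i, w i * (r i z * |(p i z - q i z) / r i z| ^ j) with hD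
  have hconv : ∀ j z, Q z * |(P z - Q z) / Q z| ^ j ≤ s ^ j * D j z := by
    intro j z
    have hpos : 0 < ∑ i, w i * r i z := hQ z ▸ hQpos z
    have := sum_mul_abs_div_pow_le w (fun i => p i z - q i z) (fun i => r i z) hw
      (fun i => (h i).pr.right_pos z) hpos j
    rw [hPQ, mul_div_assoc, abs_mul, abs_of_nonneg hs, mul_pow, mul_left_comm, hQ]
    gcongr
  have hDi : ∀ j, 1 ≤ j → Integrable (D j) ν := fun j hj =>
    integrable_finsetSum _ fun i _ => ((h i).abs_pow hj).1.const_mul _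
  have hDle : ∀ j, 1 ≤ j → ∀ B : ℝ,
      (∀ i, ∫ z, r i z * |(p i z - q i z) / r i z| ^ j ∂ν ≤ B) → ∫ z, D j z ∂ν ≤ B := by
    intro j hj B hB
    rw [hD, integral_finsetSum _ fun i _ => ((h i).abs_pow hj).1.const_mul _]
    simp_rw [integral_const_mul]
    calc _ ≤ ∑ i, w i * B := Finset.sum_le_sum fun i _ => mul_le_mul_of_nonneg_left (hB i) (hw i)
      _ = B := by rw [← Finset.sum_mul, hw1, one_mul]
  have hmem : ∀ j ∈ Finset.Icc 3 γ, 1 ≤ j := fun j hj => by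
    have := (Finset.mem_Icc.1 hj).1; omega
  have i2 : Integrable (fun z => γ.choose 2 * (s ^ 2 * D 2 z)) ν :=
    ((hDi 2 (by norm_num)).const_mul _).const_mul _
  have i3 : Integrable (fun z => ∑ j ∈ Finset.Icc 3 γ, (γ.choose j : ℝ) * (s ^ j * D j z)) ν :=
    integrable_finsetSum _ fun j hj => ((hDi j (hmem j hj)).const_mul _).const_mul _
  have i0 : Integrable (fun z => P z - Q z) ν := hPi.sub hQi
  have i1 : Integrable (fun z => Q z + γ * (P z - Q z)) ν := hQi.fun_add (i0.const_mul _)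
  set G : Z → ℝ := fun z => Q z + γ * (P z - Q z) + (γ.choose 2 * (s ^ 2 * D 2 z)
    + ∑ j ∈ Finset.Icc 3 γ, (γ.choose j : ℝ) * (s ^ j * D j z)) with hG
  have hGi : Integrable G ν := i1.fun_add (i2.fun_add i3)
  have hle : ∀ z, Q z * (P z / Q z) ^ γ ≤ G z := by
    intro z
    refine (mul_div_pow_le (hQpos z) hγ).trans ?_
    simp only [hG]
    refine add_le_add le_rfl (add_le_add ?_ ?_)
    · exact mul_le_mul_of_nonneg_left (hconv 2 z) (Nat.cast_nonneg _)
    · exact Finset.sum_le_sum fun j _ => mul_le_mul_of_nonneg_left (hconv j z) (Nat.cast_nonneg _)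
  have hG0 : ∀ z, 0 ≤ G z := fun z =>
    (mul_nonneg (hQpos z).le (pow_nonneg (div_nonneg (hPpos z).le (hQpos z).le) _)).trans (hle z)
  calc ∫⁻ z, ENNReal.ofReal (Q z) * ENNReal.ofReal (P z / Q z) ^ γ ∂ν
      ≤ ∫⁻ z, ENNReal.ofReal (G z) ∂ν := by
        refine lintegral_mono fun z => ?_
        rw [← ENNReal.ofReal_pow (div_nonneg (hPpos z).le (hQpos z).le),
          ← ENNReal.ofReal_mul (hQpos z).le]
        exact ENNReal.ofReal_le_ofReal (hle z)
    _ = ENNReal.ofReal (∫ z, G z ∂ν) :=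
        (ofReal_integral_eq_lintegral_ofReal hGi (.of_forall hG0)).symm
    _ ≤ _ := by
        refine ENNReal.ofReal_le_ofReal ?_
        have e1 : ∫ z, (Q z + γ * (P z - Q z)) ∂ν = 1 := by
          rw [integral_add hQi (i0.const_mul _), integral_const_mul,
            integral_sub hPi hQi, hQ1, hP1]
          simp
        simp only [hG]
        rw [integral_add i1 (i2.fun_add i3), integral_add i2 i3, e1, integral_const_mul,
          integral_const_mul, integral_finsetSum _ fun j hj =>
            ((hDi j (hmem j hj)).const_mul _).const_mul _]
        simp_rw [integral_const_mul]
        unfold subsampledSum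
        rw [← add_assoc, Finset.mul_sum]
        refine add_le_add (add_le_add le_rfl ?_) (Finset.sum_le_sum fun j hj => ?_)
        · have := hDle 2 (by norm_num) _ fun i => (h i).integral_sq_le
          calc (γ.choose 2 : ℝ) * (s ^ 2 * ∫ z, D 2 z ∂ν)
              ≤ (γ.choose 2 : ℝ) * (s ^ 2 * min (4 * (Real.exp a - 1)) (2 * Real.exp a)) := by
                gcongr
            _ = _ := by ring
        · have := hDle j (hmem j hj) _ fun i => ((h i).abs_pow (hmem j hj)).2
          calc (γ.choose j : ℝ) * (s ^ j * ∫ z, D j z ∂ν)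
              ≤ (γ.choose j : ℝ) * (s ^ j *
                  (4 * √(gaussAlt a (2 * (j / 2)) * gaussAlt a (2 * ((j + 1) / 2))))) := by gcongr
            _ = _ := by ring

/-- The last term of the sum, `j = γ`, alone exceeds `e ^ (c γ)` for every `c` once `γ` is large. -/
theorem tendsto_subsampledRDP {s a : ℝ} (hs : 0 < s) (ha : 0 < a) :
    Filter.Tendsto (subsampledRDP s (fun i => (i : ℝ) / 2 * a)) Filter.atTop Filter.atTop := by
  rw [Filter.tendsto_atTop]
  intro B
  set c := max B 0 with hc
  obtain ⟨X, hX⟩ := eventually_pow_le_gaussAlt ha (K := Real.exp c / s) (by positivity)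
  filter_upwards [Filter.eventually_ge_atTop (X + 3)] with γ hγ
  have hγ3 : (3 : ℝ) ≤ γ := by exact_mod_cast (by omega : 3 ≤ γ)
  set K := Real.exp c / s with hK
  have hK0 : 0 ≤ K := by positivity
  have h1 : K ^ γ ≤ √(gaussAlt a (2 * (γ / 2)) * gaussAlt a (2 * ((γ + 1) / 2))) := by
    refine Real.le_sqrt_of_sq_le ?_
    calc (K ^ γ) ^ 2 = K ^ (2 * (γ / 2)) * K ^ (2 * ((γ + 1) / 2)) := by
          rw [← pow_mul, ← pow_add]; congr 1; omega
      _ ≤ _ := by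
          have e1 := hX (2 * (γ / 2)) (by omega) (even_two_mul _)
          have e2 := hX (2 * ((γ + 1) / 2)) (by omega) (even_two_mul _)
          exact mul_le_mul e1 e2 (by positivity) ((by positivity : 0 ≤ K ^ _).trans e1)
  have h2 : Real.exp c ^ γ ≤ subsampledSum s a γ := by
    have hmin : 0 ≤ min (4 * (Real.exp a - 1)) (2 * Real.exp a) :=
      le_min (by linarith [Real.one_le_exp ha.le]) (by positivity)
    have hsum := Finset.single_le_sum (f := fun j => s ^ j * (γ.choose j : ℝ)
        * √(gaussAlt a (2 * (j / 2)) * gaussAlt a (2 * ((j + 1) / 2))))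
      (fun j _ => by positivity) (Finset.mem_Icc.2 ⟨by omega, le_refl γ⟩ : γ ∈ Finset.Icc 3 γ)
    have hterm : Real.exp c ^ γ ≤ s ^ γ * (γ.choose γ : ℝ)
        * √(gaussAlt a (2 * (γ / 2)) * gaussAlt a (2 * ((γ + 1) / 2))) := by
      calc Real.exp c ^ γ = s ^ γ * K ^ γ := by rw [← mul_pow, hK, mul_div_cancel₀ _ hs.ne']
        _ ≤ _ := by rw [Nat.choose_self, Nat.cast_one, mul_one]; gcongr
    have hpos : 0 < Real.exp c ^ γ := by positivity
    have h0 : 0 ≤ s ^ 2 * (γ.choose 2 : ℝ) * min (4 * (Real.exp a - 1)) (2 * Real.exp a) := by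
      positivity
    unfold subsampledSum
    linarith
  have h3 : γ * c ≤ Real.log (subsampledSum s a γ) := by
    rw [Real.le_log_iff_exp_le (by linarith [one_le_subsampledSum hs.le ha.le γ]),
      Real.exp_nat_mul]
    exact h2
  rw [subsampledRDP_eq, one_div, inv_mul_eq_div, le_div_iff₀ (by linarith)]
  have hcB : B ≤ c := le_max_left _ _
  have hc0 : 0 ≤ c := le_max_right _ _
  nlinarith

theorem subsampledRDP_nonneg {s a : ℝ} (hs : 0 ≤ s) (ha : 0 ≤ a) {γ : ℕ} (hγ : 2 ≤ γ) :
    0 ≤ subsampledRDP s (fun i => (i : ℝ) / 2 * a) γ := by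
  have : (2 : ℝ) ≤ γ := by exact_mod_cast hγ
  rw [subsampledRDP_eq]
  exact mul_nonneg (one_div_nonneg.2 (by linarith)) (Real.log_nonneg (one_le_subsampledSum hs ha γ))

/-! ### Inserting a worker into a random schedule -/

/-- The schedule that arises from `φ` by letting worker `i₀` change places with the worker in
position `k`, whether or not `i₀` is scheduled by `φ`. -/
def insertAt {m N : ℕ} (i₀ : Fin N) (φ : Fin m ↪ Fin N) (k : Fin m) : Fin m ↪ Fin N :=
  φ.trans (Equiv.swap i₀ (φ k)).toEmbedding

theorem insertAt_apply {m N : ℕ} (i₀ : Fin N) (φ : Fin m ↪ Fin N) (k l : Fin m) :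
    insertAt i₀ φ k l = Equiv.swap i₀ (φ k) (φ l) := rfl

theorem insertAt_self {m N : ℕ} (i₀ : Fin N) (φ : Fin m ↪ Fin N) (k : Fin m) :
    insertAt i₀ φ k k = i₀ := by
  rw [insertAt_apply, Equiv.swap_apply_right]

theorem insertAt_of_eq {m N : ℕ} {i₀ : Fin N} {φ : Fin m ↪ Fin N} {k : Fin m} (h : φ k = i₀) :
    insertAt i₀ φ k = φ := by
  ext l; simp [insertAt_apply, h]

/-- For a fixed position `k`, each schedule with `i₀` in position `k` arises from exactly `N`
schedules by `insertAt i₀ · k`, one for each worker that can stand there originally. Hence a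
uniform schedule with `i₀` inserted in a uniform position is a uniform schedule containing `i₀`. -/
theorem sum_insertAt {m N : ℕ} (i₀ : Fin N) (g : (Fin m ↪ Fin N) → ℝ)
    (hg : ∀ ψ, (∀ k, ψ k ≠ i₀) → g ψ = 0) :
    ∑ x : (Fin m ↪ Fin N) × Fin m, g (insertAt i₀ x.1 x.2) = N * ∑ ψ, g ψ := by
  have h1 : ∀ k : Fin m, ∑ φ : Fin m ↪ Fin N, g (insertAt i₀ φ k)
      = N * ∑ ψ : Fin m ↪ Fin N, if ψ k = i₀ then g ψ else 0 := by
    intro k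
    have h2 : ∀ φ : Fin m ↪ Fin N, g (insertAt i₀ φ k) = ∑ w : Fin N,
        if φ k = w then g (φ.trans (Equiv.swap i₀ w).toEmbedding) else 0 := fun φ => by
      rw [Finset.sum_ite_eq]; simp [insertAt]
    simp_rw [h2]
    rw [Finset.sum_comm]
    have h3 : ∀ w : Fin N, (∑ φ : Fin m ↪ Fin N,
        if φ k = w then g (φ.trans (Equiv.swap i₀ w).toEmbedding) else 0)
        = ∑ ψ : Fin m ↪ Fin N, if ψ k = i₀ then g ψ else 0 := by
      intro w
      refine Fintype.sum_equiv ((Equiv.refl (Fin m)).embeddingCongr (Equiv.swap i₀ w)) _ _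
        fun φ => ?_
      have e : (Equiv.refl (Fin m)).embeddingCongr (Equiv.swap i₀ w) φ
          = φ.trans (Equiv.swap i₀ w).toEmbedding := by ext; simp
      have e2 : Equiv.swap i₀ w (φ k) = i₀ ↔ φ k = w := by
        rw [Equiv.swap_apply_eq_iff, Equiv.swap_apply_left]
      rw [e]
      simp [e2]
    simp_rw [h3]
    simp
  rw [Fintype.sum_prod_type_right]
  simp_rw [h1]
  rw [← Finset.mul_sum, Finset.sum_comm]
  congr 1
  refine Finset.sum_congr rfl fun ψ _ => ?_
  by_cases h : ∃ k, ψ k = i₀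
  · obtain ⟨k, hk⟩ := h
    rw [Fintype.sum_eq_single k fun l hl => if_neg fun h' => hl (ψ.injective (h'.trans hk.symm)),
      if_pos hk]
  · push Not at h
    rw [hg ψ h]; simp

/-- Inserting worker `i₀` and changing the value of this worker moves a weighted sum of values in
`[0, 1]` by no more than the largest weight, even if `i₀` trades two unequal weights with another
worker. -/
theorem abs_sum_insertAt_sub_le {m N : ℕ} {q : Fin m → ℝ} {c : ℝ} (hq : ∀ k, q k ∈ Set.Icc 0 c)
    (i₀ : Fin N) {f f' : Fin N → ℝ} (hf : ∀ i, f i ∈ Set.Icc (0 : ℝ) 1)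
    (hf' : ∀ i, f' i ∈ Set.Icc (0 : ℝ) 1) (hff : ∀ i, i ≠ i₀ → f i = f' i)
    (φ : Fin m ↪ Fin N) (k : Fin m) :
    |∑ l, q l * f (insertAt i₀ φ k l) - ∑ l, q l * f' (φ l)| ≤ c := by
  rw [← Finset.sum_sub_distrib]
  have hfar : ∀ l, l ≠ k → φ l ≠ i₀ → q l * f (insertAt i₀ φ k l) - q l * f' (φ l) = 0 := by
    intro l hl hl'
    rw [insertAt_apply, Equiv.swap_apply_of_ne_of_ne hl' (φ.injective.ne hl), hff _ hl', sub_self]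
  have hk := hq k
  have hu := hf i₀
  have hu' := hf' i₀
  have hw := hf' (φ k)
  by_cases h : ∃ k', k' ≠ k ∧ φ k' = i₀
  · obtain ⟨k', hk', hφ⟩ := h
    have hne : φ k ≠ i₀ := fun h => hk' (φ.injective (hφ.trans h.symm))
    have hB := hq k'
    rw [Fintype.sum_eq_add k k' hk'.symm fun l hl =>
      hfar l hl.1 fun h => hl.2 (φ.injective (h.trans hφ.symm)), insertAt_self, insertAt_apply, hφ,
      Equiv.swap_apply_left, hff _ hne, abs_le]
    obtain ⟨hk0, hk1⟩ := hk
    obtain ⟨hu0, hu1⟩ := hu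
    obtain ⟨hv0, hv1⟩ := hu'
    obtain ⟨hw0, hw1⟩ := hw
    obtain ⟨hB0, hB1⟩ := hB
    constructor
    · nlinarith [mul_nonneg hk0 hu0, mul_nonneg hB0 (sub_nonneg.2 hv1),
        mul_nonneg hw0 (sub_nonneg.2 hk1), mul_nonneg (sub_nonneg.2 hw1) (sub_nonneg.2 hB1)]
    · nlinarith [mul_nonneg hk0 (sub_nonneg.2 hu1), mul_nonneg hB0 hv0,
        mul_nonneg hw0 (sub_nonneg.2 hB1), mul_nonneg (sub_nonneg.2 hw1) (sub_nonneg.2 hk1)]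
  · push Not at h
    rw [Fintype.sum_eq_single k fun l hl => hfar l hl (h l hl), insertAt_self, ← mul_sub, abs_mul,
      abs_of_nonneg hk.1]
    have : |f i₀ - f' (φ k)| ≤ 1 := abs_le.2 ⟨by linarith [hu.1, hw.2], by linarith [hu.2, hw.1]⟩
    nlinarith [hk.1, hk.2]

/-! ### Densities of shifted Gaussian laws -/

/-- The inner product of two pairs of vectors, as elements of `ℝ ^ (dX + dY)`. -/
def pairDot {dX dY : ℕ} (b z : (Fin dX → ℝ) × (Fin dY → ℝ)) : ℝ :=
  b.1 ⬝ᵥ z.1 + b.2 ⬝ᵥ z.2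

/-- The law `𝒩(0, v I)` on pairs of vectors. -/
noncomputable def gaussPair (dX dY : ℕ) (v : ℝ≥0) : Measure ((Fin dX → ℝ) × (Fin dY → ℝ)) :=
  (Measure.pi fun _ => gaussianReal 0 v).prod (Measure.pi fun _ => gaussianReal 0 v)

/-- The density of `𝒩(b, v I)` with respect to `𝒩(0, v I)`. -/
noncomputable def shiftDensity {dX dY : ℕ} (v : ℝ≥0) (b z : (Fin dX → ℝ) × (Fin dY → ℝ)) : ℝ :=
  Real.exp (pairDot b z / v - pairDot b b / (2 * v))

instance {dX dY : ℕ} (v : ℝ≥0) : IsProbabilityMeasure (gaussPair dX dY v) := by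
  unfold gaussPair; infer_instance

section

variable {dX dY : ℕ} {v : ℝ≥0}

theorem measurable_pairDot (b : (Fin dX → ℝ) × (Fin dY → ℝ)) : Measurable (pairDot b) := by
  unfold pairDot dotProduct; fun_prop

theorem measurable_shiftDensity (b : (Fin dX → ℝ) × (Fin dY → ℝ)) :
    Measurable (shiftDensity v b) := by
  have := measurable_pairDot b
  unfold shiftDensity; fun_prop

theorem shiftDensity_pos (b z : (Fin dX → ℝ) × (Fin dY → ℝ)) : 0 < shiftDensity v b z :=
  Real.exp_pos _

theorem gaussianReal_eq_withDensity (hv : v ≠ 0) (μ : ℝ) :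
    gaussianReal μ v = (gaussianReal 0 v).withDensity
      fun x => ENNReal.ofReal (Real.exp (μ * x / v - μ * μ / (2 * v))) := by
  rw [gaussianReal_of_var_ne_zero _ hv, gaussianReal_of_var_ne_zero _ hv,
    ← withDensity_mul _ (measurable_gaussianPDF 0 v) (by fun_prop)]
  congr 1
  funext x
  have hv' : (v : ℝ) ≠ 0 := by exact_mod_cast hv
  simp only [Pi.mul_apply, gaussianPDF, gaussianPDFReal]
  rw [← ENNReal.ofReal_mul (by positivity), mul_assoc _ (Real.exp _) (Real.exp _), ← Real.exp_add]
  congr 3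
  field_simp
  ring

theorem pi_gaussianReal_eq_withDensity (hv : v ≠ 0) {d : ℕ} (b : Fin d → ℝ) :
    (Measure.pi fun i => gaussianReal (b i) v)
      = (Measure.pi fun _ : Fin d => gaussianReal 0 v).withDensity
          fun z => ENNReal.ofReal (Real.exp (b ⬝ᵥ z / v - b ⬝ᵥ b / (2 * v))) := by
  have hp : ∀ i, IsProbabilityMeasure ((gaussianReal 0 v).withDensity
      fun x => ENNReal.ofReal (Real.exp (b i * x / v - b i * b i / (2 * v)))) := fun i => by
    rw [← gaussianReal_eq_withDensity hv]; infer_instance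
  simp_rw [gaussianReal_eq_withDensity hv (b _)]
  rw [pi_withDensity (fun _ => gaussianReal 0 v) _ fun i => by fun_prop]
  congr 1
  funext z
  rw [← ENNReal.ofReal_prod_of_nonneg fun i _ => (Real.exp_pos _).le, ← Real.exp_sum]
  congr 2
  simp only [dotProduct, Finset.sum_div, Finset.sum_sub_distrib]

theorem prod_pi_gaussianReal_eq_withDensity (hv : v ≠ 0) (b : (Fin dX → ℝ) × (Fin dY → ℝ)) :
    (Measure.pi fun i => gaussianReal (b.1 i) v).prod (Measure.pi fun i => gaussianReal (b.2 i) v)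
      = (gaussPair dX dY v).withDensity fun z => ENNReal.ofReal (shiftDensity v b z) := by
  rw [pi_gaussianReal_eq_withDensity hv b.1, pi_gaussianReal_eq_withDensity hv b.2,
    prod_withDensity (by unfold dotProduct; fun_prop) (by unfold dotProduct; fun_prop), gaussPair]
  congr 1
  funext z
  rw [← ENNReal.ofReal_mul (Real.exp_pos _).le, ← Real.exp_add, shiftDensity]
  congr 2
  simp only [pairDot]
  ring

theorem map_noise {σ β : ℝ} (hv : v = (σ ^ 2 / (2 * β)).toNNReal) (hβ : 0 < β)
    {d : ℕ} (b : Fin d → ℝ) :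
    (AirMixML.noise σ d).map (fun n => b + (√β)⁻¹ • n)
      = Measure.pi fun i => gaussianReal (b i) v := by
  have h1 : ∀ i, (gaussianReal 0 (σ ^ 2 / 2).toNNReal).map (fun x => b i + (√β)⁻¹ * x)
      = gaussianReal (b i) v := by
    intro i
    have : (fun x => b i + (√β)⁻¹ * x) = (fun x => b i + x) ∘ fun x => (√β)⁻¹ * x := rfl
    rw [this, ← Measure.map_map (by fun_prop) (by fun_prop), gaussianReal_map_const_mul,
      gaussianReal_map_const_add]
    congr 1
    · simp
    · rw [hv]
      ext
      simp only [NNReal.coe_mul, NNReal.coe_mk]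
      rw [Real.coe_toNNReal _ (by positivity), Real.coe_toNNReal _ (by positivity), inv_pow,
        Real.sq_sqrt hβ.le]
      field_simp
  have := Measure.pi_map_pi (μ := fun _ : Fin d => gaussianReal 0 (σ ^ 2 / 2).toNNReal)
    (f := fun i x => b i + (√β)⁻¹ * x)
    (hμ := fun i => by rw [h1]; infer_instance) fun i => by fun_prop
  simp_rw [h1] at this
  rw [← this]
  rfl

theorem integral_exp_pairDot (hv : v ≠ 0) (b : (Fin dX → ℝ) × (Fin dY → ℝ)) :
    Integrable (fun z => Real.exp (pairDot b z / v)) (gaussPair dX dY v) ∧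
      ∫ z, Real.exp (pairDot b z / v) ∂(gaussPair dX dY v)
        = Real.exp (pairDot b b / (2 * v)) := by
  have hv' : (v : ℝ) ≠ 0 := by exact_mod_cast hv
  have hpi : ∀ {d : ℕ} (b : Fin d → ℝ),
      Integrable (fun z => Real.exp (b ⬝ᵥ z / v)) (Measure.pi fun _ => gaussianReal 0 v) ∧
      ∫ z, Real.exp (b ⬝ᵥ z / v) ∂(Measure.pi fun _ => gaussianReal 0 v)
        = Real.exp (b ⬝ᵥ b / (2 * v)) := by
    intro d b
    have e : (fun z : Fin d → ℝ => Real.exp (b ⬝ᵥ z / v))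
        = fun z => ∏ i, Real.exp (b i / v * z i) := by
      funext z
      rw [← Real.exp_sum, dotProduct, Finset.sum_div]
      congr 1
      exact Finset.sum_congr rfl fun i _ => by ring
    rw [e]
    refine ⟨Integrable.fintype_prod (μ := fun _ => gaussianReal 0 v)
      (f := fun i x => Real.exp (b i / v * x)) fun i => integrable_exp_mul_gaussianReal _, ?_⟩
    rw [integral_fintype_prod_eq_prod (μ := fun _ => gaussianReal 0 v)
      (f := fun i x => Real.exp (b i / v * x)), dotProduct, Finset.sum_div, Real.exp_sum]
    refine Finset.prod_congr rfl fun i _ => ?_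
    have := congrFun (mgf_fun_id_gaussianReal (μ := 0) (v := v)) (b i / v)
    simp only [mgf] at this
    rw [this]
    congr 1
    field_simp
    ring
  have e : (fun z : (Fin dX → ℝ) × (Fin dY → ℝ) => Real.exp (pairDot b z / v))
      = fun z => Real.exp (b.1 ⬝ᵥ z.1 / v) * Real.exp (b.2 ⬝ᵥ z.2 / v) := by
    funext z
    rw [← Real.exp_add, pairDot, add_div]
  rw [e, gaussPair]
  refine ⟨(hpi b.1).1.mul_prod (hpi b.2).1, ?_⟩
  rw [integral_prod_mul (fun x => Real.exp (b.1 ⬝ᵥ x / v)) fun y => Real.exp (b.2 ⬝ᵥ y / v),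
    (hpi b.1).2, (hpi b.2).2, ← Real.exp_add, pairDot, add_div]

theorem ratioMoments_shiftDensity (hv : v ≠ 0) {a : ℝ} (p r : (Fin dX → ℝ) × (Fin dY → ℝ))
    (h : pairDot (p - r) (p - r) / v ≤ a) :
    RatioMoments (gaussPair dX dY v) a (shiftDensity v p) (shiftDensity v r) where
  left_pos := shiftDensity_pos p
  right_pos := shiftDensity_pos r
  left_meas := measurable_shiftDensity p
  right_meas := measurable_shiftDensity r
  moment := by
    refine ⟨_, h, fun i => ?_⟩
    have hv' : (v : ℝ) ≠ 0 := by exact_mod_cast hv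
    have e : (fun z => shiftDensity v r z * (shiftDensity v p z / shiftDensity v r z) ^ i)
        = fun z => Real.exp (pairDot (r + (i : ℝ) • (p - r)) z / v)
            * Real.exp (-(pairDot r r + i * (pairDot p p - pairDot r r)) / (2 * v)) := by
      funext z
      simp only [shiftDensity]
      rw [← Real.exp_sub, ← Real.exp_nat_mul, ← Real.exp_add, ← Real.exp_add]
      congr 1
      simp only [pairDot, Prod.fst_add, Prod.snd_add, Prod.smul_fst, Prod.smul_snd, Prod.fst_sub,
        Prod.snd_sub, add_dotProduct, smul_dotProduct, sub_dotProduct, smul_eq_mul]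
      field_simp
      ring
    have hI := integral_exp_pairDot hv (r + (i : ℝ) • (p - r))
    rw [e]
    refine ⟨hI.1.mul_const _, ?_⟩
    rw [integral_mul_const, hI.2, ← Real.exp_add]
    congr 1
    simp only [pairDot, Prod.fst_add, Prod.snd_add, Prod.smul_fst, Prod.smul_snd, Prod.fst_sub,
      Prod.snd_sub, add_dotProduct, smul_dotProduct, sub_dotProduct, dotProduct_add,
      dotProduct_smul, dotProduct_sub, smul_eq_mul, dotProduct_comm r.1 p.1,
      dotProduct_comm r.2 p.2]
    field_simp
    ring

end

/-! ### The law of one slot -/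

section

variable {N m dX dY : ℕ} {σ β : ℝ} {v : ℝ≥0} {q : Fin m → ℝ}

/-- The noiseless mixed-up input and label of one slot for the schedule `φ`. -/
def slotMean (q : Fin m → ℝ) (D : Dataset N dX dY) (φ : Fin m ↪ Fin N) :
    (Fin dX → ℝ) × (Fin dY → ℝ) :=
  (∑ k, q k • inputOf (D (φ k)), ∑ k, q k • labelOf (D (φ k)))

/-- The density of `slotLaw` with respect to the law of the pure noise. -/
noncomputable def slotDensity (v : ℝ≥0) (q : Fin m → ℝ) (D : Dataset N dX dY)
    (z : (Fin dX → ℝ) × (Fin dY → ℝ)) : ℝ :=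
  (Fintype.card (Fin m ↪ Fin N) : ℝ)⁻¹ * ∑ φ, shiftDensity v (slotMean q D φ) z

theorem measurable_slotDensity (D : Dataset N dX dY) : Measurable (slotDensity v q D) := by
  unfold slotDensity
  exact (Finset.measurable_fun_sum _ fun φ _ => measurable_shiftDensity _).const_mul _

theorem nonempty_schedule (hm : m ≤ N) : Nonempty (Fin m ↪ Fin N) := ⟨Fin.castLEEmb hm⟩

theorem slotDensity_pos (hm : m ≤ N) (D : Dataset N dX dY) (z) : 0 < slotDensity v q D z := by
  have := nonempty_schedule hm
  have : (0 : ℝ) < Fintype.card (Fin m ↪ Fin N) := by exact_mod_cast Fintype.card_pos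
  exact mul_pos (inv_pos.2 this)
    (Finset.sum_pos (fun φ _ => shiftDensity_pos _ _) Finset.univ_nonempty)

theorem integral_slotDensity (hv : v ≠ 0) (hm : m ≤ N) (D : Dataset N dX dY) :
    Integrable (slotDensity v q D) (gaussPair dX dY v) ∧
      ∫ z, slotDensity v q D z ∂(gaussPair dX dY v) = 1 := by
  have := nonempty_schedule hm
  have h1 : ∀ b : (Fin dX → ℝ) × (Fin dY → ℝ),
      Integrable (shiftDensity v b) (gaussPair dX dY v) ∧
        ∫ z, shiftDensity v b z ∂(gaussPair dX dY v) = 1 := by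
    intro b
    obtain ⟨a', -, h⟩ := (ratioMoments_shiftDensity hv b b le_rfl).moment
    simpa using h 0
  unfold slotDensity
  refine ⟨(integrable_finsetSum _ fun φ _ => (h1 _).1).const_mul _, ?_⟩
  rw [integral_const_mul, integral_finsetSum _ fun φ _ => (h1 _).1]
  simp only [(h1 _).2, Finset.sum_const, Finset.card_univ, nsmul_eq_mul, mul_one]
  exact inv_mul_cancel₀ (by exact_mod_cast Fintype.card_ne_zero)

theorem scheduledLaw_eq (hvv : v = (σ ^ 2 / (2 * β)).toNNReal) (hv : v ≠ 0) (hβ : 0 < β)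
    (D : Dataset N dX dY) (φ : Fin m ↪ Fin N) :
    scheduledLaw σ β q D φ = (gaussPair dX dY v).withDensity
      fun z => ENNReal.ofReal (shiftDensity v (slotMean q D φ) z) := by
  have hn : ∀ d, IsProbabilityMeasure (noise σ d) := fun d => by unfold noise; infer_instance
  rw [← prod_pi_gaussianReal_eq_withDensity hv, ← map_noise hvv hβ, ← map_noise hvv hβ,
    Measure.map_prod_map _ _ (by fun_prop) (by fun_prop)]
  rfl

theorem slotLaw_eq (hvv : v = (σ ^ 2 / (2 * β)).toNNReal) (hv : v ≠ 0) (hβ : 0 < β) (hm : m ≤ N)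
    (D : Dataset N dX dY) :
    slotLaw σ β q D = (gaussPair dX dY v).withDensity
      fun z => ENNReal.ofReal (slotDensity v q D z) := by
  have := nonempty_schedule hm
  have hc : (0 : ℝ) < Fintype.card (Fin m ↪ Fin N) := by exact_mod_cast Fintype.card_pos
  have hmeas : ∀ φ, Measurable fun z => ENNReal.ofReal (shiftDensity v (slotMean q D φ) z) :=
    fun φ => (measurable_shiftDensity _).ennreal_ofReal
  ext S hS
  rw [withDensity_apply _ hS]
  simp only [slotLaw, Measure.smul_apply, Measure.finsetSum_apply, smul_eq_mul,
    scheduledLaw_eq hvv hv hβ, withDensity_apply _ hS]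
  rw [← lintegral_finsetSum _ fun φ _ => hmeas φ,
    ← lintegral_const_mul _ (Finset.measurable_fun_sum _ fun φ _ => hmeas φ)]
  refine lintegral_congr fun z => ?_
  rw [slotDensity, ENNReal.ofReal_mul (inv_pos.2 hc).le, ENNReal.ofReal_inv_of_pos hc,
    ENNReal.ofReal_natCast, ENNReal.ofReal_sum_of_nonneg fun φ _ => (shiftDensity_pos _ _).le]

instance isProbabilityMeasure_slotLaw [hm : Fact (m ≤ N)] (D : Dataset N dX dY) :
    IsProbabilityMeasure (slotLaw σ β q D) := by
  have := nonempty_schedule hm.out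
  have hn : ∀ d, IsProbabilityMeasure (noise σ d) := fun d => by unfold noise; infer_instance
  have hs : ∀ φ, IsProbabilityMeasure (scheduledLaw σ β q D φ) := fun φ =>
    Measure.isProbabilityMeasure_map (by fun_prop)
  constructor
  simp only [slotLaw, Measure.smul_apply, Measure.finsetSum_apply, smul_eq_mul, measure_univ,
    Finset.sum_const, Finset.card_univ, nsmul_eq_mul, mul_one]
  exact ENNReal.inv_mul_cancel (by exact_mod_cast Fintype.card_ne_zero) (ENNReal.natCast_ne_top _)

theorem inputOf_mem (s : Option (Sample dX dY)) (d : Fin dX) :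
    inputOf s d ∈ Set.Icc (0 : ℝ) 1 := by
  cases s with
  | none => simp [inputOf]
  | some s => exact s.input_mem d

theorem labelOf_mem (s : Option (Sample dX dY)) (d : Fin dY) :
    labelOf s d ∈ Set.Icc (0 : ℝ) 1 := by
  cases s with
  | none => simp [labelOf]
  | some s =>
    obtain ⟨j, hj⟩ := s.label_oneHot
    simp only [labelOf, Option.elim_some, hj, Pi.single_apply]
    split_ifs <;> simp

/-- A bound for the squared sensitivity of the noiseless output to one worker, in units of
the noise variance `σ² / (2 β)`. -/
noncomputable def sensitivity (dX dY : ℕ) (σ β : ℝ) (q : Fin m → ℝ) : ℝ :=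
  ((⨆ k, q k ^ 2) * ((dX : ℝ) + dY)) / (σ ^ 2 / (2 * β))

theorem gaussRDP_eq (dX dY : ℕ) (σ β : ℝ) (q : Fin m → ℝ) :
    gaussRDP dX dY σ β q = fun i : ℕ => (i : ℝ) / 2 * sensitivity dX dY σ β q := rfl

theorem sq_le_iSup_sq (q : Fin m → ℝ) (k : Fin m) : q k ^ 2 ≤ ⨆ k, q k ^ 2 :=
  le_ciSup (f := fun k => q k ^ 2) (Set.finite_range _).bddAbove k

theorem iSup_sq_pos (hq : q ∈ stdSimplex ℝ (Fin m)) : 0 < ⨆ k, q k ^ 2 := by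
  by_contra! h
  have h0 : ∀ k, q k = 0 := fun k => by
    have := (sq_le_iSup_sq q k).trans h
    nlinarith [sq_nonneg (q k)]
  have := hq.2
  simp [h0] at this

theorem sensitivity_pos (hd : 0 < dX + dY) (hσ : 0 < σ) (hβ : 0 < β)
    (hq : q ∈ stdSimplex ℝ (Fin m)) : 0 < sensitivity dX dY σ β q := by
  have h1 := iSup_sq_pos hq
  have h2 : (0 : ℝ) < (dX : ℝ) + dY := by exact_mod_cast hd
  unfold sensitivity
  positivity

/-- Two datasets that differ in worker `i₀` only have mean outputs within the sensitivity, even if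
the schedules differ by the insertion of `i₀`. -/
theorem ratioMoments_insertAt (hvv : v = (σ ^ 2 / (2 * β)).toNNReal) (hv : v ≠ 0) (hβ : 0 < β)
    (hq : q ∈ stdSimplex ℝ (Fin m)) {i₀ : Fin N} {D D' : Dataset N dX dY}
    (h : ∀ i, i ≠ i₀ → D i = D' i) (φ : Fin m ↪ Fin N) (k : Fin m) :
    RatioMoments (gaussPair dX dY v) (sensitivity dX dY σ β q)
      (shiftDensity v (slotMean q D (insertAt i₀ φ k))) (shiftDensity v (slotMean q D' φ)) := by
  refine ratioMoments_shiftDensity hv _ _ ?_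
  have hv' : (v : ℝ) = σ ^ 2 / (2 * β) := by rw [hvv, Real.coe_toNNReal _ (by positivity)]
  have hv0 : (0 : ℝ) < v := by exact_mod_cast pos_iff_ne_zero.2 hv
  rw [sensitivity, ← hv']
  refine div_le_div_of_nonneg_right ?_ hv0.le
  set M := ⨆ k, q k ^ 2
  have hM : 0 ≤ M := (iSup_sq_pos hq).le
  have hqM : ∀ k, q k ∈ Set.Icc 0 √M := fun k => ⟨hq.1 k, Real.le_sqrt_of_sq_le (sq_le_iSup_sq q k)⟩
  have hcoord : ∀ f : Option (Sample dX dY) → ℝ, (∀ s, f s ∈ Set.Icc (0 : ℝ) 1) →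
      (∑ l, q l * f (D (insertAt i₀ φ k l)) - ∑ l, q l * f (D' (φ l)))
        * (∑ l, q l * f (D (insertAt i₀ φ k l)) - ∑ l, q l * f (D' (φ l))) ≤ M := by
    intro f hf
    have := abs_sum_insertAt_sub_le hqM i₀ (f := fun i => f (D i)) (f' := fun i => f (D' i))
      (fun i => hf _) (fun i => hf _) (fun i hi => by rw [h i hi]) φ k
    rw [← sq, ← sq_abs, ← Real.sq_sqrt hM]
    gcongr
  have h1 : ((slotMean q D (insertAt i₀ φ k) - slotMean q D' φ).1
      ⬝ᵥ (slotMean q D (insertAt i₀ φ k) - slotMean q D' φ).1) ≤ dX * M := by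
    calc _ ≤ ∑ _d : Fin dX, M := Finset.sum_le_sum fun d _ => by
          simpa [slotMean] using hcoord (fun s => inputOf s d) fun s => inputOf_mem s d
      _ = _ := by simp
  have h2 : ((slotMean q D (insertAt i₀ φ k) - slotMean q D' φ).2
      ⬝ᵥ (slotMean q D (insertAt i₀ φ k) - slotMean q D' φ).2) ≤ dY * M := by
    calc _ ≤ ∑ _d : Fin dY, M := Finset.sum_le_sum fun d _ => by
          simpa [slotMean] using hcoord (fun s => labelOf s d) fun s => labelOf_mem s d
      _ = _ := by simp
  unfold pairDot
  linarith

/-- The subsampled Rényi bound for one slot. -/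
theorem lintegral_slotDensity_le (hd : 0 < dX + dY) (hσ : 0 < σ)
    (hvv : v = (σ ^ 2 / (2 * β)).toNNReal) (hv : v ≠ 0) (hβ : 0 < β) (hm : m ≤ N)
    (hq : q ∈ stdSimplex ℝ (Fin m)) {i₀ : Fin N} {D D' : Dataset N dX dY}
    (h : ∀ i, i ≠ i₀ → D i = D' i) {γ : ℕ} (hγ : 2 ≤ γ) :
    ∫⁻ z, ENNReal.ofReal (slotDensity v q D' z)
        * ENNReal.ofReal (slotDensity v q D z / slotDensity v q D' z) ^ γ ∂(gaussPair dX dY v)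
      ≤ ENNReal.ofReal (Real.exp (((γ : ℝ) - 1)
          * subsampledRDP ((m : ℝ) / N) (gaussRDP dX dY σ β q) γ)) := by
  have := nonempty_schedule hm
  have hm0 : (m : ℝ) ≠ 0 := by
    rintro h0
    have h0 : m = 0 := by exact_mod_cast h0
    subst h0
    simpa using hq.2
  have hN0 : (N : ℝ) ≠ 0 := by
    intro h0
    have h0 : N = 0 := by exact_mod_cast h0
    exact hm0 (by exact_mod_cast (by omega : m = 0))
  set c : ℝ := (Fintype.card (Fin m ↪ Fin N) : ℝ) with hc
  have hc0 : c ≠ 0 := by rw [hc]; exact_mod_cast Fintype.card_ne_zero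
  rw [gaussRDP_eq]
  refine lintegral_mixture_le (ι := (Fin m ↪ Fin N) × Fin m) (w := fun _ => c⁻¹ * (m : ℝ)⁻¹)
    (p := fun x => shiftDensity v (slotMean q D (insertAt i₀ x.1 x.2)))
    (q := fun x => shiftDensity v (slotMean q D' (insertAt i₀ x.1 x.2)))
    (r := fun x => shiftDensity v (slotMean q D' x.1))
    (fun _ => by positivity) ?_ (by positivity) (sensitivity_pos hd hσ hβ hq).le ?_ ?_ ?_
    (slotDensity_pos hm D') (slotDensity_pos hm D) (integral_slotDensity hv hm D').1
    (integral_slotDensity hv hm D).1 (integral_slotDensity hv hm D').2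
    (integral_slotDensity hv hm D).2 hγ
  · simp only [Finset.sum_const, Finset.card_univ, Fintype.card_prod, Fintype.card_fin,
      nsmul_eq_mul, Nat.cast_mul, ← hc]
    field_simp
  · rintro ⟨φ, k⟩
    have key := fun {E E' : Dataset N dX dY} (hE : ∀ i, i ≠ i₀ → E i = E' i) =>
      ratioMoments_insertAt hvv hv hβ hq hE
    -- inserting `i₀` where it already stands changes nothing, so the bound for `insertAt` also
    -- compares the two datasets under one and the same schedule
    have hsame : insertAt i₀ (insertAt i₀ φ k) k = insertAt i₀ φ k :=
      insertAt_of_eq (insertAt_self i₀ φ k)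
    refine ⟨key h φ k, key (fun _ _ => rfl) φ k, ?_, ?_⟩
    · simpa only [hsame] using key h (insertAt i₀ φ k) k
    · simpa only [hsame] using key (fun i hi => (h i hi).symm) (insertAt i₀ φ k) k
  · intro z
    rw [slotDensity, ← Finset.mul_sum, Fintype.sum_prod_type, ← hc]
    simp only [Finset.sum_const, Finset.card_univ, Fintype.card_fin, nsmul_eq_mul]
    rw [← Finset.mul_sum]
    field_simp
  · intro z
    have := sum_insertAt i₀ (fun ψ => shiftDensity v (slotMean q D ψ) z
      - shiftDensity v (slotMean q D' ψ) z) fun ψ hψ => by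
        have : slotMean q D ψ = slotMean q D' ψ := by simp only [slotMean, h _ (hψ _)]
        rw [this, sub_self]
    rw [slotDensity, slotDensity, ← mul_sub, ← Finset.sum_sub_distrib, ← Finset.mul_sum, this, ← hc]
    field_simp

theorem slotLaw_eq_withDensity (hvv : v = (σ ^ 2 / (2 * β)).toNNReal) (hv : v ≠ 0) (hβ : 0 < β)
    (hm : m ≤ N) (D D' : Dataset N dX dY) :
    slotLaw σ β q D = (slotLaw σ β q D').withDensity
      fun z => ENNReal.ofReal (slotDensity v q D z / slotDensity v q D' z) := by
  have hD := measurable_slotDensity (v := v) (q := q) D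
  have hD' := measurable_slotDensity (v := v) (q := q) D'
  rw [slotLaw_eq hvv hv hβ hm D, slotLaw_eq hvv hv hβ hm D', ← withDensity_mul _ (by fun_prop)
    (by fun_prop)]
  congr 1
  funext z
  rw [Pi.mul_apply, ← ENNReal.ofReal_mul (slotDensity_pos hm D' z).le,
    mul_div_cancel₀ _ (slotDensity_pos hm D' z).ne']

end

/-! ### The full mechanism and the optimal order -/

theorem Adjacent.exists_agree {N dX dY : ℕ} {D D' : Dataset N dX dY} (h : Adjacent D D') :
    ∃ i₀, ∀ i, i ≠ i₀ → D i = D' i := by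
  rcases h with ⟨i₀, -, rfl⟩ | ⟨i₀, -, rfl⟩
  · exact ⟨i₀, fun i hi => (Function.update_of_ne hi _ _).symm⟩
  · exact ⟨i₀, fun i hi => Function.update_of_ne hi _ _⟩

theorem isDP_mechanism {N T dX dY : ℕ} (hd : 0 < dX + dY) {σ β δ : ℝ} (hσ : 0 < σ) (hβ : 0 < β)
    (hδ : 0 < δ) {m : Fin T → ℕ} (hm : ∀ t, m t ≤ N) {q : (t : Fin T) → Fin (m t) → ℝ}
    (hq : ∀ t, q t ∈ stdSimplex ℝ (Fin (m t))) {γ : ℕ} (hγ : 2 ≤ γ) :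
    IsDP (fun D : Dataset N dX dY => mechanism σ β q D)
      ((∑ t, subsampledRDP ((m t : ℝ) / N) (gaussRDP dX dY σ β (q t)) γ)
        + Real.log (1 / δ) / ((γ : ℝ) - 1)) δ := by
  intro D D' hDD S hS
  obtain ⟨i₀, hi⟩ := hDD.exists_agree
  obtain ⟨v, hvv⟩ : ∃ v, v = (σ ^ 2 / (2 * β)).toNNReal := ⟨_, rfl⟩
  have hv : v ≠ 0 := by rw [hvv, ← pos_iff_ne_zero, Real.toNNReal_pos]; positivity
  have hmF : ∀ t, Fact (m t ≤ N) := fun t => ⟨hm t⟩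
  set L : (t : Fin T) → (Fin dX → ℝ) × (Fin dY → ℝ) → ℝ≥0∞ := fun t z =>
    ENNReal.ofReal (slotDensity v (q t) D z / slotDensity v (q t) D' z) with hL
  have hDm := fun t => measurable_slotDensity (v := v) (q := q t) D
  have hDm' := fun t => measurable_slotDensity (v := v) (q := q t) D'
  have hLm : ∀ t, Measurable (L t) := fun t => ((hDm t).div (hDm' t)).ennreal_ofReal
  have heq : ∀ t, slotLaw σ β (q t) D = (slotLaw σ β (q t) D').withDensity (L t) := fun t =>
    slotLaw_eq_withDensity hvv hv hβ (hm t) D D'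
  have hσf : ∀ t, SigmaFinite ((slotLaw σ β (q t) D').withDensity (L t)) := fun t => by
    rw [← heq t]; infer_instance
  have := pi_withDensity_le_of_moment (fun t => slotLaw σ β (q t) D') L hLm hγ
    (fun t => subsampledRDP ((m t : ℝ) / N) (gaussRDP dX dY σ β (q t)) γ) (fun t => ?_) hδ S hS
  · simp only [mechanism, heq]
    exact this
  · rw [slotLaw_eq hvv hv hβ (hm t) D', lintegral_withDensity_eq_lintegral_mul _
      (hDm' t).ennreal_ofReal ((hLm t).pow_const _)]
    exact lintegral_slotDensity_le hd hσ hvv hv hβ (hm t) (hq t) hi hγ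

end AirMixML

open AirMixML

theorem proposition1 {N T dX dY : ℕ} (hT : 0 < T) (hd : 0 < dX + dY)
    (σ β δ r : ℝ) (hσ : 0 < σ) (hβ : 0 < β) (hδ : 0 < δ)
    (m : Fin T → ℕ) (hm : ∀ t, m t ≤ N) (hr : ∀ t, (m t : ℝ) / (N : ℝ) = r)
    (q : (t : Fin T) → Fin (m t) → ℝ) (hq : ∀ t, q t ∈ stdSimplex ℝ (Fin (m t))) :
    ∃ ε : ℝ,
      IsLeast {x : ℝ | ∃ γ : ℕ, 2 ≤ γ ∧
        x = (∑ t, AirMixML.subsampledRDP r (AirMixML.gaussRDP dX dY σ β (q t)) γ)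
          + Real.log (1 / δ) / ((γ : ℝ) - 1)} ε ∧
      AirMixML.IsDP
        (fun D : AirMixML.Dataset N dX dY => AirMixML.mechanism σ β q D) ε δ := by
  have ha : ∀ t, 0 < sensitivity dX dY σ β (q t) := fun t => sensitivity_pos hd hσ hβ (hq t)
  have t₀ : Fin T := ⟨0, hT⟩
  have hr0 : 0 < r := by
    have h0 : m t₀ ≠ 0 := by
      intro h0
      have : IsEmpty (Fin (m t₀)) := by rw [h0]; infer_instance
      simpa using (hq t₀).2
    have h1 := hm t₀
    rw [← hr t₀]
    exact div_pos (by exact_mod_cast (by omega : 0 < m t₀)) (by exact_mod_cast (by omega : 0 < N))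
  set f : ℕ → ℝ := fun γ => (∑ t, subsampledRDP r (gaussRDP dX dY σ β (q t)) γ)
    + Real.log (1 / δ) / ((γ : ℝ) - 1) with hf
  have hlim : Filter.Tendsto f Filter.atTop Filter.atTop := by
    refine Filter.tendsto_atTop_mono' _ ?_ (Filter.tendsto_atTop_add_const_right _
      (-|Real.log (1 / δ)|) (tendsto_subsampledRDP hr0 (ha t₀)))
    filter_upwards [Filter.eventually_ge_atTop 2] with γ hγ
    have hγ' : (2 : ℝ) ≤ γ := by exact_mod_cast hγ
    refine add_le_add ?_ ?_
    · exact Finset.single_le_sum (f := fun t => subsampledRDP r (gaussRDP dX dY σ β (q t)) γ)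
        (fun t _ => subsampledRDP_nonneg hr0.le (ha t).le hγ) (Finset.mem_univ t₀)
    · refine (abs_le.1 ?_).1
      rw [abs_div]
      exact div_le_self (abs_nonneg _) (by rw [abs_of_pos (by linarith)]; linarith)
  obtain ⟨n, hn⟩ := Filter.Tendsto.exists_forall_le (f := fun n => f (n + 2))
    (Nat.cofinite_eq_atTop ▸ hlim.comp (Filter.tendsto_add_atTop_nat 2))
  refine ⟨f (n + 2), ⟨⟨n + 2, by omega, rfl⟩, ?_⟩, ?_⟩
  · rintro x ⟨γ, hγ, rfl⟩
    have := hn (γ - 2)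
    rwa [Nat.sub_add_cancel hγ] at this
  · have := isDP_mechanism (N := N) hd hσ hβ hδ hm hq (γ := n + 2) (by omega)
    simp only [hr] at this
    exact this
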